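/- **Setting.** Let $\mathcal C$ be a category with binary coproducts and $\mathcal M$ a class of monomorphisms such that $(\mathcal C,\mathcal M)$ is $\mathcal M$-adhesive: $\mathcal M$ contains the isomorphisms and is closed under composition, decomposition ($g\circ f,g\in\mathcal M\Rightarrow f\in\mathcal M$), pushouts and pullbacks; pushouts and pullbacks along $\mathcal M$-morphisms exist; and pushouts along $\mathcal M$-morphisms have the van Kampen property for cubes whose vertical morphisms are in $\mathcal M$. Let $\mathcal E'$ be a class of pairs of morphisms with common codomain such that every pair $(f_1,f_2)$ with common codomain factors as $f_i=m\circ e_i$ with $(e_1,e_2)\in\mathcal E'$ and $m\in\mathcal M$, uniquely up to isomorphism. *Application conditions (ACs)* over $P$ are built from $\exists(a,c)$ ($a:P\to C$, $c$ an AC over $C$), negation and conjunction (over arbitrary index sets, in particular finite ones). A morphism $p:P\to G$ satisfies $\exists(a,c)$ if some $q:C\to G$ in $\mathcal M$ has $q\circ a=p$ and $q\models c$; the other cases are as usual. Two ACs over $P$ are equivalent if the same morphisms from $P$ satisfy them. For $b:P\to P'$, $\mathrm{Shift}(b,\cdot)$ commutes with negation and conjunction, and $\mathrm{Shift}(b,\exists(a,c))=\bigvee\exists(a',\mathrm{Shift}(b',c))$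 over all $(a',b')\in\mathcal E'$ with $b'\in\mathcal M$ and $b'\circ a=a'\circ b$. For a span $\rho=(L\leftarrow I\to R)$, $\mathrm{Left}(\rho,\cdot)$ commutes with negation and conjunction, and $\mathrm{Left}(\rho,\exists(a:R\to Q,c))=\exists(b,\mathrm{Left}(\rho^*,c))$ if the inverse span has a double pushout at match $a$, where $b:L\to Z$ is its comatch and $\rho^*=(Z\leftarrow Y\to Q)$ the resulting span; otherwise it is false. A *rule* $\rho=(p,\mathrm{ac}_L)$ is a span $p=(L\leftarrow I\to R)$ of $\mathcal M$-morphisms with an AC $\mathrm{ac}_L$ over $L$. A *plain direct transformation* $G\Rightarrow_{p,m}H$ is a double pushout $G\xleftarrow{k}D\xrightarrow{c}H$ over $p$ at the match $m:L\to G$. A *plain transformation pair* for $(\rho_1,\rho_2)$ consists of plain direct transformations of one object $G$ via $p_1$ and $p_2$, with matches $o_1,o_2$; it is a *transformation pair* if moreover $o_i\models\mathrm{ac}_{L_i}$ for $i=1,2$. A transformation pair is *parallel independent* if there are $d_{12}:L_1\to D_2$ with $k_2\circ d_{12}=o_1$, $c_2\circ d_{12}\models\mathrm{ac}_{L_1}$,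 and $d_{21}:L_2\to D_1$ with $k_1\circ d_{21}=o_2$, $c_1\circ d_{21}\models\mathrm{ac}_{L_2}$; for plain pairs the satisfaction requirements are dropped. Otherwise it is *parallel dependent*, or a *conflict*. An *embedding* of one (plain) transformation pair into another consists of an extension morphism $f:G\to G'$ compatible with the matches together with extension diagrams, i.e. morphisms $D_i\to D_i'$ and $H_i\to H_i'$ compatible with the double pushouts and making the squares over $k_i$ and $c_i$ pushouts; it is an isomorphism if all these morphisms are. A plain pair $tp^I$ is *initial* for a plain pair $tp$ if it embeds into $tp$ via some $f^I$ such that for each embedding of a plain pair $tp'$ into $tp$, via $f$ say, there is a unique embedding of $tp^I$ into $tp'$ whose extension morphism $f'$ satisfies $f\circ f'=f^I$. A *symbolic transformation pair* is a plain pair $tp_K$ on an object $K$ together with the ACs $\mathrm{ac}_K=\mathrm{Shift}(o_1,\mathrm{ac}_{L_1})\wedge\mathrm{Shift}(o_2,\mathrm{ac}_{L_2})$ and $\mathrm{ac}^*_K=\neg(\mathrm{ac}^*_{12}\wedge\mathrm{ac}^*_{21})$, where $\mathrm{ac}^*_{12}=\mathrm{Left}(K\xleftarrow{k_2}D_2\xrightarrow{c_2}P_2,\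 \mathrm{Shift}(c_2\circ d_{12},\mathrm{ac}_{L_1}))$ if some $d_{12}$ with $k_2\circ d_{12}=o_1$ exists and $\mathrm{ac}^*_{12}=\mathrm{false}$ otherwise, and $\mathrm{ac}^*_{21}$ is defined symmetrically. It is an *initial conflict* if $tp_K$ embeds into some conflict for $(\rho_1,\rho_2)$, and $tp_K$ is either a plain conflict isomorphic to an initial pair for itself, or isomorphic to the pair $R_1+L_2\Leftarrow L_1+L_2\Rightarrow L_1+R_2$ at the coproduct injections. It is *regular* if $\mathrm{ac}_K\wedge\mathrm{ac}^*_K$ is equivalent to some $\bigvee_{i\in I}\exists(a_i:K\to C_i,c_i)$ with $I$ finite and non-empty and each $c_i=\bigwedge_{j\in J_i}\neg\exists(b_{ij}:C_i\to C_{ij},d_{ij})$ with no $b_{ij}$ an isomorphism. Given such a disjunction, its *disjunctive unfolding* $\mathcal U^D$ is the set of the transformation pairs $D_{1,i}\Leftarrow_{\rho_1,a_i\circ o_1}C_i\Rightarrow_{\rho_2,a_i\circ o_2}D_{2,i}$, for those $i\in I$ for which such transformations exist (one chosen for each such $i$; they are unique up to isomorphism). **Theorem (finite and complete unfolding).** Let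 $\mathcal R$ be a set of rules such that every plain conflict for every pair of rules from $\mathcal R$ has an initial plain transformation pair. Let $\rho_1,\rho_2\in\mathcal R$ and let $\mathcal S$ be the set of initial conflicts for $(\rho_1,\rho_2)$, taken up to isomorphism (any set of initial conflicts that contains an isomorphic copy of each initial conflict). Suppose that each $stp\in\mathcal S$ is regular. Then, for any choice of the disjunctions, $\bigcup_{stp\in\mathcal S}\mathcal U^D(stp)$ is $\mathcal M$-complete w.r.t. parallel dependence: for each parallel dependent transformation pair $tp$ for $(\rho_1,\rho_2)$ some member of the union embeds into $tp$ via an extension morphism in $\mathcal M$. Moreover, $\bigcup_{stp\in\mathcal S}\mathcal U^D(stp)$ is finite if $\mathcal S$ is finite. -/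

import Mathlib

open CategoryTheory CategoryTheory.Limits

universe v u

noncomputable section

namespace MAdhesiveSystems

/-! ### M-adhesive categories and pair factorizations -/

section Categories

variable {C : Type u} [Category.{v} C]

/-- A pushout `W, X, Y, Z` has the `M`-van Kampen property: for every commutative cube over it whose
back faces are pullbacks and whose vertical morphisms are in `M`, the top face is a
pushout iff the front faces are pullbacks. -/
def IsMVanKampen (M : MorphismProperty C) {W X Y Z : C}
    (f : W ⟶ X) (g : W ⟶ Y) (h : X ⟶ Z) (i : Y ⟶ Z) : Prop :=
  ∀ ⦃W' X' Y' Z' : C⦄ (f' : W' ⟶ X') (g' : W' ⟶ Y') (h' : X' ⟶ Z') (i' : Y' ⟶ Z')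
    (αW : W' ⟶ W) (αX : X' ⟶ X) (αY : Y' ⟶ Y) (αZ : Z' ⟶ Z),
    M αW → M αX → M αY → M αZ →
    IsPullback f' αW αX f → IsPullback g' αW αY g →
    CommSq h' αX αZ h → CommSq i' αY αZ i → CommSq f' g' h' i' →
    (IsPushout f' g' h' i' ↔ IsPullback h' αX αZ h ∧ IsPullback i' αY αZ i)

/-- `(C, M)` is an `M`-adhesive category. -/
structure IsMAdhesive (M : MorphismProperty C) : Prop where
  mono : ∀ {X Y : C} (f : X ⟶ Y), M f → Mono f
  /-- all isomorphisms are in `M` -/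
  of_isIso : ∀ {X Y : C} (f : X ⟶ Y), IsIso f → M f
  /-- closure under composition -/
  comp : ∀ {X Y Z : C} (f : X ⟶ Y) (g : Y ⟶ Z), M f → M g → M (f ≫ g)
  /-- closure under decomposition -/
  decomp : ∀ {X Y Z : C} (f : X ⟶ Y) (g : Y ⟶ Z), M (f ≫ g) → M g → M f
  hasPushout : ∀ {W X Y : C} (f : W ⟶ X) (g : W ⟶ Y), M f → HasPushout f g
  hasPullback : ∀ {X Y Z : C} (f : X ⟶ Z) (g : Y ⟶ Z), M f → HasPullback f g
  /-- closure under pushouts -/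
  pushout : ∀ {W X Y Z : C} {f : W ⟶ X} {g : W ⟶ Y} {h : X ⟶ Z} {i : Y ⟶ Z},
    IsPushout f g h i → M f → M i
  /-- closure under pullbacks -/
  pullback : ∀ {W X Y Z : C} {f : W ⟶ X} {g : W ⟶ Y} {h : X ⟶ Z} {i : Y ⟶ Z},
    IsPullback f g h i → M i → M f
  vanKampen : ∀ {W X Y Z : C} {f : W ⟶ X} {g : W ⟶ Y} {h : X ⟶ Z} {i : Y ⟶ Z},
    IsPushout f g h i → M f → IsMVanKampen M f g h i

variable (C) in
/-- A class of pairs of morphisms with the same codomain. -/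
abbrev PairClass := ∀ ⦃A B K : C⦄, (A ⟶ K) → (B ⟶ K) → Prop

/-- `C` has a unique `E'`-`M` pair factorization: each pair `(f₁, f₂)` with common codomain factors
as `(e₁, e₂) ∈ E'` followed by some `m ∈ M`, uniquely up to isomorphism. -/
structure HasUniquePairFactorization (E' : PairClass C) (M : MorphismProperty C) : Prop where
  exists_factorization : ∀ {A B X : C} (f₁ : A ⟶ X) (f₂ : B ⟶ X),
    ∃ (K : C) (e₁ : A ⟶ K) (e₂ : B ⟶ K) (m : K ⟶ X),
      E' e₁ e₂ ∧ M m ∧ e₁ ≫ m = f₁ ∧ e₂ ≫ m = f₂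
  unique : ∀ {A B X K K' : C} (e₁ : A ⟶ K) (e₂ : B ⟶ K) (m : K ⟶ X)
    (e₁' : A ⟶ K') (e₂' : B ⟶ K') (m' : K' ⟶ X),
    E' e₁ e₂ → M m → E' e₁' e₂' → M m' → e₁ ≫ m = e₁' ≫ m' → e₂ ≫ m = e₂' ≫ m' →
    ∃ φ : K ≅ K', e₁ ≫ φ.hom = e₁' ∧ e₂ ≫ φ.hom = e₂' ∧ φ.hom ≫ m' = m

end Categories

/-! ### Double pushouts and extension diagrams -/

section DPO

variable {C : Type u} [Category.{v} C]

/-- A double pushout over the span `L ⟵l- I -r⟶ R` at the match `m : L ⟶ G`: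
```
L ⟵l- I -r⟶ R
|m    |g    |comatch
G ⟵k- D -c⟶ H
```
-/
structure DPO {L I R : C} (l : I ⟶ L) (r : I ⟶ R) {G : C} (m : L ⟶ G) where
  D : C
  H : C
  g : I ⟶ D
  k : D ⟶ G
  c : D ⟶ H
  comatch : R ⟶ H
  left : IsPushout l g m k
  right : IsPushout r g comatch c

/-- An extension diagram over the extension morphism `f : G ⟶ G'`, embedding a direct transformation
`t` at match `m` into a direct transformation `t'` at match `m' = m ≫ f` via the same rule. -/
structure DPO.Extension {L I R : C} {l : I ⟶ L} {r : I ⟶ R} {G G' : C} {m : L ⟶ G} {m' : L ⟶ G'}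
    (t : DPO l r m) (t' : DPO l r m') (f : G ⟶ G') where
  match_comm : m ≫ f = m'
  d : t.D ⟶ t'.D
  h : t.H ⟶ t'.H
  g_comm : t.g ≫ d = t'.g
  comatch_comm : t.comatch ≫ h = t'.comatch
  left : IsPushout t.k d f t'.k
  right : IsPushout t.c d h t'.c

end DPO

/-! ### Nested application conditions -/

section Conditions

variable {C : Type u} [Category.{v} C]

/-- (Nested) application conditions over an object. The index set of a conjunction may be any
small set; the conditions with finite index sets only are among them. -/
inductive AC : C → Type (max u v + 1)
  | ex {P Q : C} (a : P ⟶ Q) (c : AC Q) : AC P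
  | neg {P : C} (c : AC P) : AC P
  | conj {P : C} (ι : Type (max u v)) (c : ι → AC P) : AC P

namespace AC

/-- The empty conjunction. -/
def tt (P : C) : AC P := conj PEmpty (fun x => x.elim)

def ff (P : C) : AC P := neg (tt P)

def and {P : C} (c c' : AC P) : AC P := conj (ULift Bool) (fun x => if x.down then c else c')

def disj {P : C} (ι : Type (max u v)) (c : ι → AC P) : AC P := neg (conj ι (fun i => neg (c i)))

/-- Satisfaction `p ⊨ c` of an application condition by a morphism. -/
def Sat (M : MorphismProperty C) : {P : C} → AC P → ∀ {G : C}, (P ⟶ G) → Prop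
  | _, ex a c, _, p => ∃ q, M q ∧ a ≫ q = p ∧ Sat M c q
  | _, neg c, _, p => ¬ Sat M c p
  | _, conj _ c, _, p => ∀ i, Sat M (c i) p

/-- Equivalence of application conditions over the same object. -/
def Equivalent (M : MorphismProperty C) {P : C} (c c' : AC P) : Prop :=
  ∀ ⦃G : C⦄ (p : P ⟶ G), Sat M c p ↔ Sat M c' p

/-- The index set of the disjunction `Shift(b, ∃(a, c))`: pairs `(a', b') ∈ E'` with `b' ∈ M`
completing `a` and `b` to a commutative square. -/
structure ShiftIndex (E' : PairClass C) (M : MorphismProperty C) {P Q P' : C}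
    (a : P ⟶ Q) (b : P ⟶ P') where
  Q' : C
  a' : P' ⟶ Q'
  b' : Q ⟶ Q'
  mem : E' a' b'
  mem_M : M b'
  comm : a ≫ b' = b ≫ a'

/-- `Shift(b, c)`: shift of an application condition over a morphism. -/
def shift (E' : PairClass C) (M : MorphismProperty C) :
    {P : C} → AC P → ∀ {P' : C}, (P ⟶ P') → AC P'
  | _, ex a c, _, b => disj (ShiftIndex E' M a b) (fun x => ex x.a' (shift E' M c x.b'))
  | _, neg c, _, b => neg (shift E' M c b)
  | _, conj ι c, _, b => conj ι (fun i => shift E' M (c i) b)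

open Classical in
/-- `Left(ρ, c)` for the plain rule `ρ = (L ⟵l- I -r⟶ R)` and an application condition `c` on `R`.
For `c = ∃(a : R ⟶ Q, c')`, if `(r, a)` has a pushout complement, it is
`∃(b, Left(ρ*, c'))`, where the double pushout along the inverse rule
```
R ⟵r- I -l⟶ L
|a    |     |b
Q ⟵k- D -c⟶ H
```
yields `b` and the derived rule `ρ* = (H ⟵ D ⟶ Q)`; otherwise it is false. -/
def left : {R : C} → AC R → ∀ {L I : C}, (I ⟶ L) → (I ⟶ R) → AC L
  | _, ex a c, L, _, l, r =>
      if h : Nonempty (DPO r l a) then ex h.some.comatch (left c h.some.c h.some.k) else ff L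
  | _, neg c, _, _, l, r => neg (left c l r)
  | _, conj ι c, _, _, l, r => conj ι (fun i => left (c i) l r)

end AC

end Conditions

/-! ### Rules, transformation pairs, parallel independence -/

section Rules

variable {C : Type u} [Category.{v} C]

/-- A plain rule `L ⟵ I ⟶ R` with both morphisms in `M`. -/
structure PlainRule (M : MorphismProperty C) where
  L : C
  I : C
  R : C
  l : I ⟶ L
  r : I ⟶ R
  l_mem : M l
  r_mem : M r

/-- A rule: a plain rule with an application condition over its left-hand side. -/
structure Rule (M : MorphismProperty C) extends PlainRule M where
  ac : AC L

variable {M : MorphismProperty C}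

/-- A pair of plain (AC-disregarding) direct transformations `H₁ ⇐ G ⇒ H₂` via `p₁` and `p₂`. -/
structure PlainPair (p₁ p₂ : PlainRule M) where
  G : C
  o₁ : p₁.L ⟶ G
  o₂ : p₂.L ⟶ G
  t₁ : DPO p₁.l p₁.r o₁
  t₂ : DPO p₂.l p₂.r o₂

/-- Parallel independence of plain transformation pairs. -/
def PlainPair.ParallelIndependent {p₁ p₂ : PlainRule M} (tp : PlainPair p₁ p₂) : Prop :=
  (∃ d₁₂ : p₁.L ⟶ tp.t₂.D, d₁₂ ≫ tp.t₂.k = tp.o₁) ∧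
  (∃ d₂₁ : p₂.L ⟶ tp.t₁.D, d₂₁ ≫ tp.t₁.k = tp.o₂)

/-- A transformation pair: both matches satisfy the application conditions of the rules. -/
structure TransformationPair (ρ₁ ρ₂ : Rule M) extends
    PlainPair ρ₁.toPlainRule ρ₂.toPlainRule where
  sat₁ : ρ₁.ac.Sat M o₁
  sat₂ : ρ₂.ac.Sat M o₂

/-- Parallel independence of transformation pairs via rules with application conditions. A pair
is parallel dependent (a conflict) if this fails. -/
def TransformationPair.ParallelIndependent {ρ₁ ρ₂ : Rule M} (tp : TransformationPair ρ₁ ρ₂) :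
    Prop :=
  (∃ d₁₂ : ρ₁.L ⟶ tp.t₂.D, d₁₂ ≫ tp.t₂.k = tp.o₁ ∧ ρ₁.ac.Sat M (d₁₂ ≫ tp.t₂.c)) ∧
  (∃ d₂₁ : ρ₂.L ⟶ tp.t₁.D, d₂₁ ≫ tp.t₁.k = tp.o₂ ∧ ρ₂.ac.Sat M (d₂₁ ≫ tp.t₁.c))

/-- An embedding of `tp` into `tp'`: an extension morphism with extension diagrams for both
direct transformations. -/
structure PlainPair.Embedding {p₁ p₂ : PlainRule M} (tp tp' : PlainPair p₁ p₂) where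
  f : tp.G ⟶ tp'.G
  ext₁ : DPO.Extension tp.t₁ tp'.t₁ f
  ext₂ : DPO.Extension tp.t₂ tp'.t₂ f

/-- Isomorphism of transformation pairs. -/
def PlainPair.Isomorphic {p₁ p₂ : PlainRule M} (tp tp' : PlainPair p₁ p₂) : Prop :=
  ∃ e : tp.Embedding tp', IsIso e.f ∧ IsIso e.ext₁.d ∧ IsIso e.ext₁.h ∧
    IsIso e.ext₂.d ∧ IsIso e.ext₂.h

/-- A set of transformation pairs is `M`-complete w.r.t. parallel dependence. -/
def MComplete {ρ₁ ρ₂ : Rule M} (S : Set (TransformationPair ρ₁ ρ₂)) : Prop :=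
  ∀ tp : TransformationPair ρ₁ ρ₂, ¬ tp.ParallelIndependent →
    ∃ t ∈ S, ∃ e : t.toPlainPair.Embedding tp.toPlainPair, M e.f

end Rules

/-! ### Initial transformation pairs -/

section Initial

variable {C : Type u} [Category.{v} C] {M : MorphismProperty C}

/-- `tpI` is an initial transformation pair for the plain transformation pair `tp`. -/
def PlainPair.IsInitialFor {p₁ p₂ : PlainRule M} (tpI tp : PlainPair p₁ p₂) : Prop :=
  ∃ eI : tpI.Embedding tp, ∀ (tp' : PlainPair p₁ p₂) (e : tp'.Embedding tp),
    ∃! e' : tpI.Embedding tp', e'.f ≫ e.f = eI.f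

/-- The system with rule set `𝓡` has initial transformation pairs for conflicts along plain rules. -/
def HasInitialPairsForConflicts (𝓡 : Set (Rule M)) : Prop :=
  ∀ ρ₁ ∈ 𝓡, ∀ ρ₂ ∈ 𝓡, ∀ tp : PlainPair ρ₁.toPlainRule ρ₂.toPlainRule,
    ¬ tp.ParallelIndependent → ∃ tpI, PlainPair.IsInitialFor tpI tp

/-- Initial conflicts for plain rules: conflicts that are isomorphic to their initial
transformation pair. -/
def PlainPair.IsInitialConflict {p₁ p₂ : PlainRule M} (tp : PlainPair p₁ p₂) : Prop :=
  ¬ tp.ParallelIndependent ∧ ∃ tpI, PlainPair.IsInitialFor tpI tp ∧ tp.Isomorphic tpI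

theorem isPushout_coprod_inl [HasBinaryCoproducts C] {A B : C} (f : A ⟶ B) (X : C) :
    IsPushout f (coprod.inl : A ⟶ A ⨿ X) coprod.inl (coprod.map f (𝟙 X)) :=
  (IsPushout.of_coprod_inl_with_id f X).flip

theorem isPushout_coprod_inr [HasBinaryCoproducts C] {A B : C} (f : A ⟶ B) (X : C) :
    IsPushout f (coprod.inr : A ⟶ X ⨿ A) coprod.inr (coprod.map (𝟙 X) f) := by
  have key : ∀ {W : C} (u : B ⟶ W) (w : X ⨿ A ⟶ W), f ≫ u = coprod.inr ≫ w →
      ∃ n : X ⨿ B ⟶ W, coprod.inr ≫ n = u ∧ coprod.map (𝟙 X) f ≫ n = w ∧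
        ∀ n' : X ⨿ B ⟶ W, coprod.inr ≫ n' = u → coprod.map (𝟙 X) f ≫ n' = w → n' = n := by
    intro W u w huw
    refine ⟨coprod.desc (coprod.inl ≫ w) u, coprod.inr_desc _ _, ?_, ?_⟩
    · ext
      · simp [coprod.inl_desc]
      · simp [huw, coprod.inr_desc]
    · rintro n' h₁ h₂
      ext
      · simp [← h₂, coprod.inl_desc]
      · simp [h₁, coprod.inr_desc]
  refine ⟨⟨by simp⟩, ⟨PushoutCocone.isColimitAux' _ (fun s => ?_)⟩⟩
  have h := key s.inl s.inr s.condition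
  exact ⟨h.choose, h.choose_spec.1, h.choose_spec.2.1,
    fun {m} h₁ h₂ => h.choose_spec.2.2 m h₁ h₂⟩

/-- The transformation pair `R₁ + L₂ ⇐ L₁ + L₂ ⇒ L₁ + R₂` at the coproduct injections. -/
def coprodPair [HasBinaryCoproducts C] (p₁ p₂ : PlainRule M) : PlainPair p₁ p₂ where
  G := p₁.L ⨿ p₂.L
  o₁ := coprod.inl
  o₂ := coprod.inr
  t₁ :=
    { D := p₁.I ⨿ p₂.L
      H := p₁.R ⨿ p₂.L
      g := coprod.inl
      k := coprod.map p₁.l (𝟙 _)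
      c := coprod.map p₁.r (𝟙 _)
      comatch := coprod.inl
      left := isPushout_coprod_inl _ _
      right := isPushout_coprod_inl _ _ }
  t₂ :=
    { D := p₁.L ⨿ p₂.I
      H := p₁.L ⨿ p₂.R
      g := coprod.inr
      k := coprod.map (𝟙 _) p₂.l
      c := coprod.map (𝟙 _) p₂.r
      comatch := coprod.inr
      left := isPushout_coprod_inr _ _
      right := isPushout_coprod_inr _ _ }

/-- The initial parallel independent transformation pair (up to isomorphism). -/
def PlainPair.IsInitialParallelIndependent [HasBinaryCoproducts C] {p₁ p₂ : PlainRule M}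
    (tp : PlainPair p₁ p₂) : Prop :=
  tp.Isomorphic (coprodPair p₁ p₂)

end Initial

/-! ### Symbolic transformation pairs and initial conflicts -/

section Symbolic

variable {C : Type u} [Category.{v} C] {M : MorphismProperty C}

/-- A symbolic transformation pair consists of an AC-disregarding transformation pair `tp` on an
object `K` and the two application conditions `extensionAC` and `conflictAC` on `K`,
which are functions of `tp`. -/
structure SymbolicPair (ρ₁ ρ₂ : Rule M) where
  tp : PlainPair ρ₁.toPlainRule ρ₂.toPlainRule

namespace SymbolicPair

variable {ρ₁ ρ₂ : Rule M} (E' : PairClass C) (s : SymbolicPair ρ₁ ρ₂)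

/-- The extension AC `ac_K = Shift(o₁, ac_{L₁}) ∧ Shift(o₂, ac_{L₂})`. -/
def extensionAC : AC s.tp.G :=
  (ρ₁.ac.shift E' M s.tp.o₁).and (ρ₂.ac.shift E' M s.tp.o₂)

open Classical in
/-- `Left(p₂*, Shift(c₂ ∘ d₁₂, ac_{L₁}))` if `d₁₂` with `k₂ ∘ d₁₂ = o₁` exists, else false. -/
def conflictAC₁₂ : AC s.tp.G :=
  if h : ∃ d₁₂ : ρ₁.L ⟶ s.tp.t₂.D, d₁₂ ≫ s.tp.t₂.k = s.tp.o₁ then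
    (ρ₁.ac.shift E' M (h.choose ≫ s.tp.t₂.c)).left s.tp.t₂.k s.tp.t₂.c
  else AC.ff _

open Classical in
/-- `Left(p₁*, Shift(c₁ ∘ d₂₁, ac_{L₂}))` if `d₂₁` with `k₁ ∘ d₂₁ = o₂` exists, else false. -/
def conflictAC₂₁ : AC s.tp.G :=
  if h : ∃ d₂₁ : ρ₂.L ⟶ s.tp.t₁.D, d₂₁ ≫ s.tp.t₁.k = s.tp.o₂ then
    (ρ₂.ac.shift E' M (h.choose ≫ s.tp.t₁.c)).left s.tp.t₁.k s.tp.t₁.c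
  else AC.ff _

/-- The conflict-inducing AC `ac*_K`. -/
def conflictAC : AC s.tp.G :=
  AC.neg ((s.conflictAC₁₂ E').and (s.conflictAC₂₁ E'))

/-- The unfolding `𝓤(s)`: all transformation pairs in the lower row of an extension diagram with
upper row `s.tp`. -/
def unfolding : Set (TransformationPair ρ₁ ρ₂) :=
  {t | Nonempty (s.tp.Embedding t.toPlainPair)}

def IsConflictInducing : Prop :=
  ∃ t ∈ s.unfolding, ¬ t.ParallelIndependent

/-- Initial conflicts for rules with application conditions. -/
def IsInitialConflict [HasBinaryCoproducts C] : Prop :=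
  s.IsConflictInducing ∧ (s.tp.IsInitialConflict ∨ s.tp.IsInitialParallelIndependent)

/-- A presentation of `s` as regular: `ac_K ∧ ac*_K` is equivalent to a disjunction
`⋁_{i ∈ ι} ∃(aᵢ : K ⟶ Cᵢ, ⋀_{j ∈ κ i} ¬∃(bᵢⱼ : Cᵢ ⟶ Cᵢⱼ, dᵢⱼ))` over a finite
non-empty set `ι`, with no `bᵢⱼ` an isomorphism. -/
structure RegularForm where
  ι : Type (max u v)
  finite : Finite ι
  nonempty : Nonempty ι
  Ci : ι → C
  a : ∀ i, s.tp.G ⟶ Ci i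
  κ : ι → Type (max u v)
  Cij : ∀ i, κ i → C
  b : ∀ i j, Ci i ⟶ Cij i j
  d : ∀ i j, AC (Cij i j)
  b_not_iso : ∀ i j, ¬ IsIso (b i j)
  equiv : AC.Equivalent M ((s.extensionAC E').and (s.conflictAC E'))
    (AC.disj ι (fun i => AC.ex (a i) (AC.conj (κ i) (fun j => AC.neg (AC.ex (b i j) (d i j))))))

def IsRegular : Prop := Nonempty (s.RegularForm E')

variable {E' s}

/-- The disjunctive unfolding: the transformation pairs `D₁ᵢ ⇐ Cᵢ ⇒ D₂ᵢ` at the matches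
`aᵢ ∘ o₁` and `aᵢ ∘ o₂`, for those `i` for which these matches admit such transformations. Double
pushouts are unique up to isomorphism; one is chosen for each match. -/
def RegularForm.disjunctiveUnfolding (F : s.RegularForm E') : Set (TransformationPair ρ₁ ρ₂) :=
  {t | ∃ (i : F.ι)
      (h₁ : Nonempty (DPO ρ₁.l ρ₁.r (s.tp.o₁ ≫ F.a i)))
      (h₂ : Nonempty (DPO ρ₂.l ρ₂.r (s.tp.o₂ ≫ F.a i)))
      (s₁ : ρ₁.ac.Sat M (s.tp.o₁ ≫ F.a i)) (s₂ : ρ₂.ac.Sat M (s.tp.o₂ ≫ F.a i)),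
      t = { G := F.Ci i, o₁ := s.tp.o₁ ≫ F.a i, o₂ := s.tp.o₂ ≫ F.a i
            t₁ := h₁.some, t₂ := h₂.some, sat₁ := s₁, sat₂ := s₂ }}

end SymbolicPair

/-- `S` is the set of initial conflicts for `(ρ₁, ρ₂)`, taken up to isomorphism: it consists of
initial conflicts and contains an isomorphic copy of each initial conflict. The set of all
initial conflicts and each set of representatives of its isomorphism classes are examples. -/
def IsSetOfInitialConflicts [HasBinaryCoproducts C] {ρ₁ ρ₂ : Rule M}
    (S : Set (SymbolicPair ρ₁ ρ₂)) : Prop :=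
  (∀ s ∈ S, s.IsInitialConflict) ∧
  ∀ s : SymbolicPair ρ₁ ρ₂, s.IsInitialConflict → ∃ s' ∈ S, s.tp.Isomorphic s'.tp

end Symbolic

end MAdhesiveSystems

end

open MAdhesiveSystems

namespace MAdhesiveSystems

/-! ### Pushouts along `M`-morphisms -/

section Squares

variable {C : Type u} [Category.{v} C]

/-! Every conflict extends some initial conflict: if its plain pair is dependent, its initial pair
embeds into it; if the plain pair is independent, the coproduct pair does
(`exists_initialConflict_embedding`). The extension morphism `f` satisfies both conditions of the
symbolic pair, because `Shift` and `Left` translate conditions on the matches into conditions on `K`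
(`AC.sat_shift`, `AC.sat_left`). By regularity `f` then factors as `a i ≫ q` with `q` in `M`.

Conversely, `a i` alone satisfies the disjunction: the identity of `Ci i` violates none of the
negative conditions, since no `b i j` is an isomorphism (`AC.sat_conj_neg_ex_id`). Hence the matches
into `Ci i` satisfy the conditions of the rules. Double pushouts restrict along `M`-morphisms, by
the van Kampen property (`exists_dpo_extension`), so the transformations at `Ci i` exist and embed
via `q`. Finiteness holds because each index contributes at most one pair. -/

theorem isPullback_id_comp_of_mono {X Y Z : C} (x : X ⟶ Y) (y : Y ⟶ Z) [Mono y] :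
    IsPullback x (𝟙 X) y (x ≫ y) := by
  have h₁ : IsPullback x (𝟙 X) (𝟙 Y) x := IsPullback.of_vert_isIso ⟨by simp⟩
  have h₂ : IsPullback (𝟙 Y) (𝟙 Y) y y := IsKernelPair.id_of_mono y
  simpa using h₁.paste_horiz h₂

namespace IsMAdhesive

variable {M : MorphismProperty C} (hM : IsMAdhesive M)
include hM

/-- Pushouts along `M`-morphisms are pullbacks. -/
theorem isPullback_of_isPushout {W X Y Z : C} {f : W ⟶ X} {g : W ⟶ Y} {h : X ⟶ Z} {i : Y ⟶ Z}
    (sq : IsPushout f g h i) (hf : M f) : IsPullback f g h i := by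
  have := hM.mono f hf
  -- The cube over `sq` with this trivial pushout as top has `sq` itself, flipped, as a front face.
  have top : IsPushout (𝟙 W) g g (𝟙 Y) := IsPushout.of_horiz_isIso ⟨by simp⟩
  have key := (hM.vanKampen sq hf (𝟙 W) g g (𝟙 Y) (𝟙 W) f (𝟙 Y) i
    (hM.of_isIso _ inferInstance) hf (hM.of_isIso _ inferInstance) (hM.pushout sq hf)
    (IsKernelPair.id_of_mono f) (IsPullback.of_vert_isIso ⟨by simp⟩) ⟨sq.w.symm⟩ ⟨by simp⟩
    ⟨by simp⟩).1 top
  exact key.1.flip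

/-- Restriction of a pushout along an `M`-morphism `q` into its corner. -/
theorem isPushout_restrict {I L D G D₀ G₀ : C} {l : I ⟶ L} {g : I ⟶ D} {m : L ⟶ G₀} {q : G₀ ⟶ G}
    {k : D ⟶ G} {k₀ : D₀ ⟶ G₀} {d : D₀ ⟶ D} {g₀ : I ⟶ D₀} (sq : IsPushout l g (m ≫ q) k)
    (hl : M l) (hq : M q) (pb : IsPullback k₀ d q k) (hg : g₀ ≫ d = g) (hk : l ≫ m = g₀ ≫ k₀) :
    IsPushout l g₀ m k₀ := by
  subst hg
  have := hM.mono q hq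
  have hd : M d := hM.pullback pb.flip hq
  have := hM.mono d hd
  -- The square sought is the top of a cube over `sq`; its front faces are pullbacks because `q` is
  -- mono and by `pb`.
  exact (hM.vanKampen sq hl l g₀ m k₀ (𝟙 I) (𝟙 L) d q
    (hM.of_isIso _ inferInstance) (hM.of_isIso _ inferInstance) hd hq
    (IsPullback.of_vert_isIso ⟨by simp⟩) (isPullback_id_comp_of_mono g₀ d) ⟨by simp⟩ ⟨pb.w⟩
    ⟨hk⟩).2 ⟨isPullback_id_comp_of_mono m q, pb⟩

/-- Pull `sq₁` back along `k₂`. Since `sq₂` is also a pullback, `L` pulls back to `I` and `l` to an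
identity; van Kampen makes the result a pushout, so `p₂` is a pushout of that identity. -/
theorem isIso_snd_of_isPushout_of_isPushout {I L G D₁ D₂ P : C} {l : I ⟶ L} {m : L ⟶ G}
    {g₁ : I ⟶ D₁} {k₁ : D₁ ⟶ G} {g₂ : I ⟶ D₂} {k₂ : D₂ ⟶ G} {p₁ : P ⟶ D₁} {p₂ : P ⟶ D₂}
    (sq₁ : IsPushout l g₁ m k₁) (sq₂ : IsPushout l g₂ m k₂) (hl : M l)
    (pb : IsPullback p₁ p₂ k₁ k₂) : IsIso p₂ := by
  have := hM.mono l hl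
  have hk₂ : M k₂ := hM.pushout sq₂ hl
  have hp₁ : M p₁ := hM.pullback pb hk₂
  have := hM.mono p₁ hp₁
  obtain ⟨w, hw₁, hw₂⟩ : ∃ w : I ⟶ P, w ≫ p₁ = g₁ ∧ w ≫ p₂ = g₂ :=
    ⟨pb.lift g₁ g₂ (by rw [← sq₁.w, ← sq₂.w]), by simp, by simp⟩
  subst hw₁
  have top : IsPushout (𝟙 I) w g₂ p₂ :=
    (hM.vanKampen sq₁ hl (𝟙 I) w g₂ p₂ (𝟙 I) l p₁ k₂
      (hM.of_isIso _ inferInstance) hl hp₁ hk₂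
      (IsKernelPair.id_of_mono l) (isPullback_id_comp_of_mono w p₁) ⟨sq₂.w.symm⟩ ⟨pb.w.symm⟩
      ⟨by simp [hw₂]⟩).2 ⟨(hM.isPullback_of_isPushout sq₂ hl).flip, pb.flip⟩
  exact top.isIso_inr_of_isIso

/-- Pushout complements along `M`-morphisms are unique up to isomorphism. -/
theorem exists_iso_of_isPushout_of_isPushout {I L G D₁ D₂ : C} {l : I ⟶ L} {m : L ⟶ G}
    {g₁ : I ⟶ D₁} {k₁ : D₁ ⟶ G} {g₂ : I ⟶ D₂} {k₂ : D₂ ⟶ G}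
    (sq₁ : IsPushout l g₁ m k₁) (sq₂ : IsPushout l g₂ m k₂) (hl : M l) :
    ∃ φ : D₁ ≅ D₂, g₁ ≫ φ.hom = g₂ ∧ φ.hom ≫ k₂ = k₁ := by
  have hk₂ : M k₂ := hM.pushout sq₂ hl
  have := hM.mono k₂ hk₂
  have : HasPullback k₁ k₂ := hM.hasPullback k₁ k₂ (hM.pushout sq₁ hl)
  have pb := IsPullback.of_hasPullback k₁ k₂
  have := hM.isIso_snd_of_isPushout_of_isPushout sq₁ sq₂ hl pb
  have := hM.isIso_snd_of_isPushout_of_isPushout sq₂ sq₁ hl pb.flip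
  have hφ : ((asIso (pullback.fst k₁ k₂)).symm ≪≫ asIso (pullback.snd k₁ k₂)).hom ≫ k₂ = k₁ := by
    simp [← pb.w]
  refine ⟨(asIso (pullback.fst k₁ k₂)).symm ≪≫ asIso (pullback.snd k₁ k₂), ?_, hφ⟩
  rw [← cancel_mono k₂, Category.assoc, hφ, ← sq₁.w, sq₂.w]

end IsMAdhesive

end Squares

/-! ### Extending and restricting double pushouts -/

section Transformations

variable {C : Type u} [Category.{v} C]

/-- The double pushout along the inverse rule. -/
def DPO.inverse {L I R G : C} {l : I ⟶ L} {r : I ⟶ R} {m : L ⟶ G} (t : DPO l r m) :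
    DPO r l t.comatch :=
  ⟨t.D, G, t.g, t.c, t.k, m, t.right, t.left⟩

namespace DPO.Extension

variable {L I R G G' G'' : C} {l : I ⟶ L} {r : I ⟶ R} {m : L ⟶ G} {m' : L ⟶ G'} {m'' : L ⟶ G''}

def id (t : DPO l r m) : Extension t t (𝟙 G) where
  match_comm := by simp
  d := 𝟙 _
  h := 𝟙 _
  g_comm := by simp
  comatch_comm := by simp
  left := IsPushout.of_vert_isIso ⟨by simp⟩
  right := IsPushout.of_vert_isIso ⟨by simp⟩

def comp {t : DPO l r m} {t' : DPO l r m'} {t'' : DPO l r m''} {f : G ⟶ G'} {f' : G' ⟶ G''}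
    (e : Extension t t' f) (e' : Extension t' t'' f') : Extension t t'' (f ≫ f') where
  match_comm := by rw [← Category.assoc, e.match_comm, e'.match_comm]
  d := e.d ≫ e'.d
  h := e.h ≫ e'.h
  g_comm := by rw [← Category.assoc, e.g_comm, e'.g_comm]
  comatch_comm := by rw [← Category.assoc, e.comatch_comm, e'.comatch_comm]
  left := e.left.paste_vert e'.left
  right := e.right.paste_vert e'.right

noncomputable def inv {t : DPO l r m} {t' : DPO l r m'} {f : G ⟶ G'} (e : Extension t t' f)
    [IsIso f] [IsIso e.d] [IsIso e.h] : Extension t' t (CategoryTheory.inv f) where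
  match_comm := by simp [← e.match_comm]
  d := CategoryTheory.inv e.d
  h := CategoryTheory.inv e.h
  g_comm := by simp [← e.g_comm]
  comatch_comm := by simp [← e.comatch_comm]
  left := IsPushout.of_vert_isIso ⟨by simp [← reassoc_of% e.left.w]⟩
  right := IsPushout.of_vert_isIso ⟨by simp [← reassoc_of% e.right.w]⟩

/-- The lower row of an extension diagram, as a double pushout along the derived rule. -/
def derived {t : DPO l r m} {t' : DPO l r m'} {f : G ⟶ G'} (e : Extension t t' f) :
    DPO t.k t.c f :=
  ⟨t'.D, t'.H, e.d, t'.k, t'.c, e.h, e.left, e.right⟩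

end DPO.Extension

namespace IsMAdhesive

variable {M : MorphismProperty C} (hM : IsMAdhesive M)
include hM

/-- Restriction of a double pushout along an `M`-morphism. -/
theorem exists_dpo_extension {L I R G G' : C} {l : I ⟶ L} {r : I ⟶ R} {m : L ⟶ G} {m' : L ⟶ G'}
    (hl : M l) (hr : M r) (t' : DPO l r m') {q : G ⟶ G'} (hq : M q) (hm : m ≫ q = m') :
    ∃ (t : DPO l r m) (e : t.Extension t' q), M e.d ∧ M e.h := by
  subst hm
  have := hM.hasPullback q t'.k hq
  -- The restricted context is the part of `t'.D` lying over `G`; the restricted result is then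
  -- forced as a pushout.
  have pb := IsPullback.of_hasPullback q t'.k
  obtain ⟨g₀, hg, hk⟩ : ∃ g₀ : I ⟶ Limits.pullback q t'.k,
      g₀ ≫ pullback.snd q t'.k = t'.g ∧ l ≫ m = g₀ ≫ pullback.fst q t'.k :=
    ⟨pb.lift (l ≫ m) t'.g (by rw [Category.assoc, t'.left.w]), by simp, by simp⟩
  have sq := hM.isPushout_restrict t'.left hl hq pb hg hk
  have := hM.hasPushout r g₀ hr
  have po := IsPushout.of_hasPushout r g₀
  obtain ⟨h, h₁, h₂⟩ : ∃ h : Limits.pushout r g₀ ⟶ t'.H, pushout.inl r g₀ ≫ h = t'.comatch ∧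
      pushout.inr r g₀ ≫ h = pullback.snd q t'.k ≫ t'.c :=
    ⟨po.desc t'.comatch (pullback.snd q t'.k ≫ t'.c)
      (by rw [← Category.assoc, hg, t'.right.w]), by simp, by simp⟩
  have hd : M (pullback.snd q t'.k) := hM.pullback pb.flip hq
  have right : IsPushout (pushout.inr r g₀) (pullback.snd q t'.k) h t'.c :=
    IsPushout.of_top (by rw [hg, h₁]; exact t'.right) h₂ po
  refine ⟨⟨_, _, g₀, pullback.fst q t'.k, pushout.inr r g₀, pushout.inl r g₀, sq, po⟩,
    ⟨rfl, pullback.snd q t'.k, h, hg, h₁, ?_, right⟩, hd, hM.pushout right.flip hd⟩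
  exact IsPushout.of_top (by rw [hg]; exact t'.left) pb.w sq

/-- Double pushouts at the same match are isomorphic. -/
theorem exists_extension_id {L I R G : C} {l : I ⟶ L} {r : I ⟶ R} {m : L ⟶ G}
    (hl : M l) (t t' : DPO l r m) :
    ∃ e : t.Extension t' (𝟙 G), IsIso e.d ∧ IsIso e.h := by
  obtain ⟨φ, hg, hk⟩ := hM.exists_iso_of_isPushout_of_isPushout t.left t'.left hl
  have po : IsPushout r t.g t'.comatch (φ.hom ≫ t'.c) :=
    t'.right.of_iso (Iso.refl _) (Iso.refl _) φ.symm (Iso.refl _) (by simp) (by simp [← hg])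
      (by simp) (by simp)
  let ψ : t.H ≅ t'.H := t.right.isoIsPushout _ _ po
  have h₁ : t.comatch ≫ ψ.hom = t'.comatch := IsPushout.inl_isoIsPushout_hom _ _ t.right po
  have h₂ : t.c ≫ ψ.hom = φ.hom ≫ t'.c := IsPushout.inr_isoIsPushout_hom _ _ t.right po
  exact ⟨⟨by simp, φ.hom, ψ.hom, hg, h₁, IsPushout.of_vert_isIso ⟨by simp [hk]⟩,
    IsPushout.of_vert_isIso ⟨h₂⟩⟩, inferInstance, inferInstance⟩

/-- Restricting `t'` yields a double pushout at the match of `t`, hence isomorphic to `t`.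
Membership of `e.h` in `M` is what later carries witnesses of existential conditions across a rule.
-/
theorem exists_extension {L I R G G' : C} {l : I ⟶ L} {r : I ⟶ R} {m : L ⟶ G} {m' : L ⟶ G'}
    (hl : M l) (hr : M r) (t : DPO l r m) (t' : DPO l r m') {q : G ⟶ G'} (hq : M q)
    (hm : m ≫ q = m') : ∃ e : t.Extension t' q, M e.d ∧ M e.h := by
  obtain ⟨t₀, e₀, hd, hh⟩ := hM.exists_dpo_extension hl hr t' hq hm
  obtain ⟨e, _, _⟩ := hM.exists_extension_id hl t t₀
  have key : ∃ e : t.Extension t' (𝟙 G ≫ q), M e.d ∧ M e.h :=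
    ⟨e.comp e₀, hM.comp _ _ (hM.of_isIso _ ‹_›) hd, hM.comp _ _ (hM.of_isIso _ ‹_›) hh⟩
  rwa [Category.id_comp] at key

end IsMAdhesive

end Transformations

/-! ### Semantics of `Shift` and `Left` -/

section Conditions

variable {C : Type u} [Category.{v} C] {M : MorphismProperty C}

namespace AC

@[simp] theorem sat_ex {P Q G : C} (a : P ⟶ Q) (c : AC Q) (p : P ⟶ G) :
    Sat M (ex a c) p ↔ ∃ q, M q ∧ a ≫ q = p ∧ Sat M c q := Iff.rfl

@[simp] theorem sat_neg {P G : C} (c : AC P) (p : P ⟶ G) : Sat M (neg c) p ↔ ¬ Sat M c p := Iff.rfl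

@[simp] theorem sat_conj {P G : C} (ι : Type (max u v)) (c : ι → AC P) (p : P ⟶ G) :
    Sat M (conj ι c) p ↔ ∀ i, Sat M (c i) p := Iff.rfl

@[simp] theorem not_sat_ff {P G : C} (p : P ⟶ G) : ¬ Sat M (ff P) p :=
  fun h => h (fun i => i.elim)

@[simp] theorem sat_and {P G : C} (c c' : AC P) (p : P ⟶ G) :
    Sat M (c.and c') p ↔ Sat M c p ∧ Sat M c' p := by
  simp [AC.and, ULift.forall, and_comm]

@[simp] theorem sat_disj {P G : C} (ι : Type (max u v)) (c : ι → AC P) (p : P ⟶ G) :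
    Sat M (disj ι c) p ↔ ∃ i, Sat M (c i) p := by
  simp [disj]

/-- In the existential case, a witness `q` for `b ≫ p` is factored jointly with `p`: the second
component of the pair is in `M` by decomposition and gives the index of the disjunction, while the
`M`-part is the new witness. -/
theorem sat_shift (hM : IsMAdhesive M) {E' : PairClass C} (hE : HasUniquePairFactorization E' M)
    {P : C} (c : AC P) {P' G : C} (b : P ⟶ P') (p : P' ⟶ G) :
    Sat M (shift E' M c b) p ↔ Sat M c (b ≫ p) := by
  induction c generalizing P' G with
  | ex a c ih =>
    simp only [shift, sat_disj, sat_ex, ih]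
    constructor
    · rintro ⟨x, q, hq, rfl, hs⟩
      exact ⟨x.b' ≫ q, hM.comp _ _ x.mem_M hq, by rw [reassoc_of% x.comm], hs⟩
    · rintro ⟨q, hq, hc, hs⟩
      obtain ⟨K, e₁, e₂, m, he, hm, rfl, rfl⟩ := hE.exists_factorization p q
      have := hM.mono m hm
      refine ⟨⟨K, e₁, e₂, he, hM.decomp _ _ hq hm, ?_⟩, m, hm, rfl, hs⟩
      rw [← cancel_mono m, Category.assoc, hc, Category.assoc]
  | neg c ih => simp [shift, ih]
  | conj ι c ih => simp [shift, ih]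

/-- A witness on either side is an extension morphism for the double pushout at `a` or for its
inverse, and the extension diagram turns it into a witness on the other side; its lower row feeds
the induction. If no double pushout exists at `a`, there is no witness on the right either, as
restricting `t.inverse` along it would produce one. -/
theorem sat_left (hM : IsMAdhesive M) {R : C} (c : AC R) {L I G : C} {l : I ⟶ L} {r : I ⟶ R}
    (hl : M l) (hr : M r) {m : L ⟶ G} (t : DPO l r m) :
    Sat M (left c l r) m ↔ Sat M c t.comatch := by
  induction c generalizing L I G with
  | ex a c ih =>
    simp only [left]
    split_ifs with h
    · have hc := hM.pushout h.some.right hl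
      have hk := hM.pushout h.some.left hr
      simp only [sat_ex]
      constructor
      · rintro ⟨q, hq, hm, hs⟩
        obtain ⟨e, -, hh⟩ := hM.exists_extension hl hr h.some.inverse t hq hm
        exact ⟨e.h, hh, e.comatch_comm, (ih hc hk e.derived).1 hs⟩
      · rintro ⟨q, hq, hm, hs⟩
        obtain ⟨e, -, hh⟩ := hM.exists_extension hr hl h.some t.inverse hq hm
        exact ⟨e.h, hh, e.comatch_comm, (ih hc hk e.derived.inverse).2 hs⟩
    · refine iff_of_false (not_sat_ff _) ?_
      rintro ⟨q, hq, hm, -⟩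
      obtain ⟨t₀, -⟩ := hM.exists_dpo_extension hr hl t.inverse hq hm
      exact h ⟨t₀⟩
  | neg c ih => simp [left, ih hl hr t]
  | conj ι c ih => simp [left, fun i => ih i hl hr t]

/-- A violation would make some `b j` a section of a monomorphism `q`, hence an isomorphism. -/
theorem sat_conj_neg_ex_id (hM : IsMAdhesive M) {P : C} {κ : Type (max u v)} {Q : κ → C}
    (b : ∀ j, P ⟶ Q j) (d : ∀ j, AC (Q j)) (hb : ∀ j, ¬ IsIso (b j)) :
    Sat M (conj κ (fun j => neg (ex (b j) (d j)))) (𝟙 P) := by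
  rintro j ⟨q, hq, hbq, -⟩
  have := hM.mono q hq
  exact hb j ⟨q, hbq, by rw [← cancel_mono q, Category.assoc, hbq]; simp⟩

end AC

end Conditions

/-! ### Embeddings and initial pairs -/

section Embeddings

variable {C : Type u} [Category.{v} C] {M : MorphismProperty C}

namespace PlainPair

variable {p₁ p₂ : PlainRule M}

namespace Embedding

def id (tp : PlainPair p₁ p₂) : Embedding tp tp :=
  ⟨𝟙 _, DPO.Extension.id _, DPO.Extension.id _⟩

def comp {tp tp' tp'' : PlainPair p₁ p₂} (e : Embedding tp tp') (e' : Embedding tp' tp'') :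
    Embedding tp tp'' :=
  ⟨e.f ≫ e'.f, e.ext₁.comp e'.ext₁, e.ext₂.comp e'.ext₂⟩

end Embedding

theorem Isomorphic.refl (tp : PlainPair p₁ p₂) : tp.Isomorphic tp :=
  ⟨Embedding.id tp, inferInstanceAs (IsIso (𝟙 _)), inferInstanceAs (IsIso (𝟙 _)),
    inferInstanceAs (IsIso (𝟙 _)), inferInstanceAs (IsIso (𝟙 _)), inferInstanceAs (IsIso (𝟙 _))⟩

theorem Isomorphic.nonempty_embedding_symm {tp tp' : PlainPair p₁ p₂} (h : tp.Isomorphic tp') :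
    Nonempty (tp'.Embedding tp) := by
  obtain ⟨e, _, _, _, _, _⟩ := h
  exact ⟨⟨inv e.f, e.ext₁.inv, e.ext₂.inv⟩⟩

theorem ParallelIndependent.of_embedding {tp tp' : PlainPair p₁ p₂} (e : tp.Embedding tp')
    (h : tp.ParallelIndependent) : tp'.ParallelIndependent := by
  obtain ⟨⟨d₁₂, h₁₂⟩, d₂₁, h₂₁⟩ := h
  refine ⟨⟨d₁₂ ≫ e.ext₂.d, ?_⟩, d₂₁ ≫ e.ext₁.d, ?_⟩
  · rw [Category.assoc, ← e.ext₂.left.w, reassoc_of% h₁₂, e.ext₁.match_comm]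
  · rw [Category.assoc, ← e.ext₁.left.w, reassoc_of% h₂₁, e.ext₂.match_comm]

/-- Embeddings into `tpI` become embeddings into `tp` after composing with `eI`. The embedding so
obtained, followed by `e`, and the identity are endo-embeddings of `tpI` over `eI`, so they coincide
by uniqueness. -/
theorem IsInitialFor.self {tpI tp : PlainPair p₁ p₂} (h : tpI.IsInitialFor tp) :
    tpI.IsInitialFor tpI := by
  obtain ⟨eI, hI⟩ := h
  refine ⟨Embedding.id tpI, fun tp' e => ?_⟩
  obtain ⟨e', he', huniq⟩ := hI tp' (e.comp eI)
  have he'' : e'.f ≫ e.f ≫ eI.f = eI.f := he'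
  have key : e'.comp e = Embedding.id tpI :=
    (hI tpI eI).unique (by simpa [Embedding.comp] using he'') (by simp [Embedding.id])
  refine ⟨e', congrArg Embedding.f key, fun e₀ he₀ => huniq e₀ ?_⟩
  have he₀' : e₀.f ≫ e.f = 𝟙 _ := he₀
  simp [Embedding.comp, reassoc_of% he₀']

/-- The initial pair for a plain conflict is an initial conflict. -/
theorem IsInitialFor.isInitialConflict {tpI tp : PlainPair p₁ p₂} (h : tpI.IsInitialFor tp)
    (htp : ¬ tp.ParallelIndependent) : tpI.IsInitialConflict :=
  ⟨fun hI => htp (hI.of_embedding h.choose), tpI, h.self, Isomorphic.refl tpI⟩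

/-- The coproduct pair embeds into each plain parallel independent pair. -/
theorem ParallelIndependent.nonempty_embedding_coprodPair [HasBinaryCoproducts C]
    {tp : PlainPair p₁ p₂} (h : tp.ParallelIndependent) :
    Nonempty ((coprodPair p₁ p₂).Embedding tp) := by
  obtain ⟨⟨d₁₂, h₁₂⟩, d₂₁, h₂₁⟩ := h
  refine ⟨⟨coprod.desc tp.o₁ tp.o₂, ?_, ?_⟩⟩
  · refine ⟨coprod.inl_desc _ _, coprod.desc tp.t₁.g d₂₁, coprod.desc tp.t₁.comatch (d₂₁ ≫ tp.t₁.c),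
      coprod.inl_desc _ _, coprod.inl_desc _ _, ?_, ?_⟩
    -- Pushout cancellation: pasting the coproduct square on top gives a pushout of `tp.t₁`. The
    -- other three squares are alike.
    · refine IsPushout.of_top (h₁₁ := p₁.l) (v₁₁ := coprod.inl) (v₁₂ := coprod.inl) ?_ ?_
        (isPushout_coprod_inl _ _)
      · rw [coprod.inl_desc, coprod.inl_desc]
        exact tp.t₁.left
      · ext <;> simp [coprodPair, tp.t₁.left.w, h₂₁]
    · refine IsPushout.of_top (h₁₁ := p₁.r) (v₁₁ := coprod.inl) (v₁₂ := coprod.inl) ?_ ?_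
        (isPushout_coprod_inl _ _)
      · rw [coprod.inl_desc, coprod.inl_desc]
        exact tp.t₁.right
      · ext <;> simp [coprodPair, tp.t₁.right.w]
  · refine ⟨coprod.inr_desc _ _, coprod.desc d₁₂ tp.t₂.g, coprod.desc (d₁₂ ≫ tp.t₂.c) tp.t₂.comatch,
      coprod.inr_desc _ _, coprod.inr_desc _ _, ?_, ?_⟩
    · refine IsPushout.of_top (h₁₁ := p₂.l) (v₁₁ := coprod.inr) (v₁₂ := coprod.inr) ?_ ?_
        (isPushout_coprod_inr _ _)
      · rw [coprod.inr_desc, coprod.inr_desc]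
        exact tp.t₂.left
      · ext <;> simp [coprodPair, tp.t₂.left.w, h₁₂]
    · refine IsPushout.of_top (h₁₁ := p₂.r) (v₁₁ := coprod.inr) (v₁₂ := coprod.inr) ?_ ?_
        (isPushout_coprod_inr _ _)
      · rw [coprod.inr_desc, coprod.inr_desc]
        exact tp.t₂.right
      · ext <;> simp [coprodPair, tp.t₂.right.w]

end PlainPair

namespace TransformationPair

variable {ρ₁ ρ₂ : Rule M}

/-- Each conflict extends some member of a set of initial conflicts. -/
theorem exists_initialConflict_embedding [HasBinaryCoproducts C] {𝓡 : Set (Rule M)}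
    (hinit : HasInitialPairsForConflicts 𝓡) (hρ₁ : ρ₁ ∈ 𝓡) (hρ₂ : ρ₂ ∈ 𝓡)
    {S : Set (SymbolicPair ρ₁ ρ₂)} (hS : IsSetOfInitialConflicts S)
    (tp : TransformationPair ρ₁ ρ₂) (htp : ¬ tp.ParallelIndependent) :
    ∃ s ∈ S, Nonempty (s.tp.Embedding tp.toPlainPair) := by
  suffices h : ∃ s : SymbolicPair ρ₁ ρ₂, s.IsInitialConflict ∧
      Nonempty (s.tp.Embedding tp.toPlainPair) by
    obtain ⟨s, hs, ⟨e⟩⟩ := h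
    obtain ⟨s', hs', hiso⟩ := hS.2 s hs
    obtain ⟨e'⟩ := hiso.nonempty_embedding_symm
    exact ⟨s', hs', ⟨e'.comp e⟩⟩
  -- In either case `tp` itself witnesses that the symbolic pair is conflict-inducing.
  by_cases hp : tp.toPlainPair.ParallelIndependent
  · have he := hp.nonempty_embedding_coprodPair
    exact ⟨⟨coprodPair _ _⟩, ⟨⟨tp, he, htp⟩, Or.inr (PlainPair.Isomorphic.refl _)⟩, he⟩
  · obtain ⟨tpI, hI⟩ := hinit ρ₁ hρ₁ ρ₂ hρ₂ tp.toPlainPair hp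
    have he : Nonempty (tpI.Embedding tp.toPlainPair) := ⟨hI.choose⟩
    exact ⟨⟨tpI⟩, ⟨⟨tp, he, htp⟩, Or.inl (hI.isInitialConflict hp)⟩, he⟩

end TransformationPair

/-! ### Symbolic pairs and their disjunctive unfoldings -/

namespace SymbolicPair

variable {ρ₁ ρ₂ : Rule M} (hM : IsMAdhesive M) {E' : PairClass C}
  (hE : HasUniquePairFactorization E' M) {s : SymbolicPair ρ₁ ρ₂}
include hM hE

theorem sat_extensionAC {G : C} (p : s.tp.G ⟶ G) :
    (s.extensionAC E').Sat M p ↔ ρ₁.ac.Sat M (s.tp.o₁ ≫ p) ∧ ρ₂.ac.Sat M (s.tp.o₂ ≫ p) := by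
  simp [extensionAC, AC.sat_shift hM hE]

/-- The morphism `d₁₂` of `s.tp` is transported along `e.ext₂.d`. `Left` is evaluated on the lower
row of the extension diagram, a double pushout along the derived rule. -/
theorem exists_sat_of_sat_conflictAC₁₂ {tp : PlainPair ρ₁.toPlainRule ρ₂.toPlainRule}
    (e : s.tp.Embedding tp) (h : (s.conflictAC₁₂ E').Sat M e.f) :
    ∃ d₁₂ : ρ₁.L ⟶ tp.t₂.D, d₁₂ ≫ tp.t₂.k = tp.o₁ ∧ ρ₁.ac.Sat M (d₁₂ ≫ tp.t₂.c) := by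
  unfold conflictAC₁₂ at h
  split_ifs at h with hd
  · have hsat := (AC.sat_left hM _ (hM.pushout s.tp.t₂.left ρ₂.l_mem)
      (hM.pushout s.tp.t₂.right ρ₂.r_mem) e.ext₂.derived).1 h
    rw [AC.sat_shift hM hE] at hsat
    refine ⟨hd.choose ≫ e.ext₂.d, ?_, ?_⟩
    · rw [Category.assoc, ← e.ext₂.left.w, reassoc_of% hd.choose_spec, e.ext₁.match_comm]
    · rw [Category.assoc, ← e.ext₂.right.w, ← Category.assoc]
      exact hsat
  · exact absurd h (AC.not_sat_ff _)

theorem exists_sat_of_sat_conflictAC₂₁ {tp : PlainPair ρ₁.toPlainRule ρ₂.toPlainRule}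
    (e : s.tp.Embedding tp) (h : (s.conflictAC₂₁ E').Sat M e.f) :
    ∃ d₂₁ : ρ₂.L ⟶ tp.t₁.D, d₂₁ ≫ tp.t₁.k = tp.o₂ ∧ ρ₂.ac.Sat M (d₂₁ ≫ tp.t₁.c) := by
  unfold conflictAC₂₁ at h
  split_ifs at h with hd
  · have hsat := (AC.sat_left hM _ (hM.pushout s.tp.t₁.left ρ₁.l_mem)
      (hM.pushout s.tp.t₁.right ρ₁.r_mem) e.ext₁.derived).1 h
    rw [AC.sat_shift hM hE] at hsat
    refine ⟨hd.choose ≫ e.ext₁.d, ?_, ?_⟩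
    · rw [Category.assoc, ← e.ext₁.left.w, reassoc_of% hd.choose_spec, e.ext₂.match_comm]
    · rw [Category.assoc, ← e.ext₁.right.w, ← Category.assoc]
      exact hsat
  · exact absurd h (AC.not_sat_ff _)

/-- The extension morphism of an embedding into a conflict satisfies both conditions of `s`. -/
theorem sat_of_embedding {tp : TransformationPair ρ₁ ρ₂} (htp : ¬ tp.ParallelIndependent)
    (e : s.tp.Embedding tp.toPlainPair) :
    ((s.extensionAC E').and (s.conflictAC E')).Sat M e.f := by
  rw [AC.sat_and, sat_extensionAC hM hE, e.ext₁.match_comm, e.ext₂.match_comm, conflictAC,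
    AC.sat_neg, AC.sat_and]
  exact ⟨⟨tp.sat₁, tp.sat₂⟩, fun h => htp
    ⟨exists_sat_of_sat_conflictAC₁₂ hM hE e h.1, exists_sat_of_sat_conflictAC₂₁ hM hE e h.2⟩⟩

theorem RegularForm.exists_mem_disjunctiveUnfolding (F : s.RegularForm E')
    {tp : TransformationPair ρ₁ ρ₂} (htp : ¬ tp.ParallelIndependent)
    (e : s.tp.Embedding tp.toPlainPair) :
    ∃ t ∈ F.disjunctiveUnfolding, ∃ e' : t.toPlainPair.Embedding tp.toPlainPair, M e'.f := by
  obtain ⟨i, q, hq, hqf, -⟩ := (AC.sat_disj _ _ _).1 ((F.equiv e.f).1 (sat_of_embedding hM hE htp e))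
  -- The witness for the `i`-th disjunct is the identity of `F.Ci i`.
  have hsat : ((s.extensionAC E').and (s.conflictAC E')).Sat M (F.a i) :=
    (F.equiv _).2 ((AC.sat_disj _ _ _).2 ⟨i, 𝟙 _, hM.of_isIso _ inferInstance, by simp,
      AC.sat_conj_neg_ex_id hM _ _ (F.b_not_iso i)⟩)
  obtain ⟨s₁, s₂⟩ := (sat_extensionAC hM hE _).1 ((AC.sat_and _ _ _).1 hsat).1
  have hm₁ : (s.tp.o₁ ≫ F.a i) ≫ q = tp.o₁ := by rw [Category.assoc, hqf, e.ext₁.match_comm]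
  have hm₂ : (s.tp.o₂ ≫ F.a i) ≫ q = tp.o₂ := by rw [Category.assoc, hqf, e.ext₂.match_comm]
  obtain ⟨t₁, -⟩ := hM.exists_dpo_extension ρ₁.l_mem ρ₁.r_mem tp.t₁ hq hm₁
  obtain ⟨t₂, -⟩ := hM.exists_dpo_extension ρ₂.l_mem ρ₂.r_mem tp.t₂ hq hm₂
  -- The unfolding contains the chosen double pushouts, not `t₁` and `t₂`, so the extension diagrams
  -- must start from the chosen ones.
  obtain ⟨e₁, -⟩ := hM.exists_extension ρ₁.l_mem ρ₁.r_mem (Nonempty.intro t₁).some tp.t₁ hq hm₁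
  obtain ⟨e₂, -⟩ := hM.exists_extension ρ₂.l_mem ρ₂.r_mem (Nonempty.intro t₂).some tp.t₂ hq hm₂
  exact ⟨_, ⟨i, ⟨t₁⟩, ⟨t₂⟩, s₁, s₂, rfl⟩, ⟨q, e₁, e₂⟩, hq⟩

omit hM hE in
theorem RegularForm.finite_disjunctiveUnfolding (F : s.RegularForm E') :
    F.disjunctiveUnfolding.Finite := by
  have := F.finite
  -- For fixed `i` all remaining data are proofs, so proof irrelevance leaves at most one pair.
  refine Set.Finite.subset (Set.finite_iUnion fun i : F.ι => Set.Subsingleton.finite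
    (s := {t | ∃ h₁ h₂ s₁ s₂, t =
      { G := F.Ci i, o₁ := s.tp.o₁ ≫ F.a i, o₂ := s.tp.o₂ ≫ F.a i
        t₁ := Nonempty.some h₁, t₂ := Nonempty.some h₂, sat₁ := s₁, sat₂ := s₂ }}) ?_) ?_
  · rintro _ ⟨_, _, _, _, rfl⟩ _ ⟨_, _, _, _, rfl⟩
    rfl
  · rintro t ⟨i, ht⟩
    exact Set.mem_iUnion.2 ⟨i, ht⟩

end SymbolicPair

end Embeddings

end MAdhesiveSystems

/-! ### Completeness and finiteness of the unfolding -/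

theorem mainTheorem5 {C : Type u} [Category.{v} C] [HasBinaryCoproducts C]
    (M : MorphismProperty C) (hM : IsMAdhesive M)
    (E' : PairClass C) (hE : HasUniquePairFactorization E' M)
    (𝓡 : Set (Rule M)) (hinit : HasInitialPairsForConflicts 𝓡)
    (ρ₁ ρ₂ : Rule M) (hρ₁ : ρ₁ ∈ 𝓡) (hρ₂ : ρ₂ ∈ 𝓡)
    (S : Set (SymbolicPair ρ₁ ρ₂)) (hS : IsSetOfInitialConflicts S)
    (hreg : ∀ s ∈ S, s.IsRegular E')
    (F : ∀ s : S, s.1.RegularForm E') :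
    MComplete (⋃ s : S, (F s).disjunctiveUnfolding) ∧
      (S.Finite → (⋃ s : S, (F s).disjunctiveUnfolding).Finite) := by
  refine ⟨fun tp htp => ?_, fun hfin => ?_⟩
  · obtain ⟨s, hs, ⟨e⟩⟩ :=
      TransformationPair.exists_initialConflict_embedding hinit hρ₁ hρ₂ hS tp htp
    obtain ⟨t, ht, e', he'⟩ :=
      SymbolicPair.RegularForm.exists_mem_disjunctiveUnfolding hM hE (F ⟨s, hs⟩) htp e
    exact ⟨t, Set.mem_iUnion.2 ⟨⟨s, hs⟩, ht⟩, e', he'⟩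
  · have := hfin.to_subtype
    exact Set.finite_iUnion fun s => (F s).finite_disjunctiveUnfolding
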